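/- Let $n\ge 2$. Write vectors of $\mathbb{R}^{n(n-1)}$ as $x=(x_{ij})$, indexed by the ordered pairs of distinct $i,j\in[n]=\{1,\dots,n\}$, and write $x\oplus y\oplus z\in\mathbb{R}^{3n(n-1)}$ for the concatenation of three such vectors. The diameter polytope $P^n$ of the linear ordering problem (LOP) on $n$ elements is the convex hull of all $x\oplus y\oplus z\in\{0,1\}^{3n(n-1)}$ such that \[ x_{ij}+x_{ji}=1,\qquad y_{ij}+y_{ji}=1\qquad (i<j), \] \[ x_{ij}+x_{jk}+x_{ki}\le 2,\qquad y_{ij}+y_{jk}+y_{ki}\le 2\qquad (i<j,\ i<k,\ j\ne k), \] \[ x_{ij}+y_{ij}-z_{ij}\le 1\qquad (i\neq j), \] for all $i,j,k\in[n]$. An inequality $a^{T}v\le a_0$ defines a facet of a polytope $P$ if it holds for all $v\in P$ and the face $\{v\in P: a^{T}v=a_0\}$ has dimension $\dim P-1$, where the dimension of a set is the dimension of its affine hull (and $\dim\emptyset=-1$). Theorem. Let $a_x,a_y,a_z\in\mathbb{R}^{n(n-1)}$ and $a_0\in\mathbb{R}$, and suppose that $(a_x\oplus a_y\oplus a_z)^{T}(x\oplus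 y\oplus z)\le a_0$ defines a facet of $P^n$. Define $\hat a_x\in\mathbb{R}^{n(n+1)}$ by $(\hat a_x)_{ij}=(a_x)_{ij}$ for all distinct $i,j\in[n]$ and $(\hat a_x)_{i,n+1}=(\hat a_x)_{n+1,i}=0$ for all $i\in[n]$, and define $\hat a_y,\hat a_z$ from $a_y,a_z$ in the same way. Then $(\hat a_x\oplus\hat a_y\oplus\hat a_z)^{T}(x\oplus y\oplus z)\le a_0$ defines a facet of $P^{n+1}$. -/

import Mathlib

namespace LOD

/-- The dimension of a set `S ⊆ ℝ^ι`: the dimension of its affine hull, with `dim ∅ = -1`. -/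
noncomputable def dim {ι : Type} (S : Set (ι → ℝ)) : ℤ :=
  open Classical in
  if S = ∅ then -1 else (Module.finrank ℝ (affineSpan ℝ S).direction : ℤ)

/-- The face `{v ∈ P | aᵀ v = a₀}` of `P`. -/
def face {ι : Type} [Fintype ι] (P : Set (ι → ℝ)) (a : ι → ℝ) (a₀ : ℝ) : Set (ι → ℝ) :=
  {v | v ∈ P ∧ a ⬝ᵥ v = a₀}

/-- `aᵀ v ≤ a₀` defines a facet of `P`: it is valid for `P`, and the face it defines has
dimension `dim P - 1`. -/
def DefinesFacet {ι : Type} [Fintype ι] (P : Set (ι → ℝ)) (a : ι → ℝ) (a₀ : ℝ) : Prop :=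
  (∀ v ∈ P, a ⬝ᵥ v ≤ a₀) ∧ dim (face P a a₀) = dim P - 1

/-- The `n(n-1)` ordered pairs `(i, j)` of distinct elements. -/
abbrev Pair (n : ℕ) : Type := {p : Fin n × Fin n // p.1 ≠ p.2}

/-- The pair `(i, j)`, `i ≠ j`. -/
abbrev pair {n : ℕ} (i j : Fin n) (h : i ≠ j) : Pair n := ⟨(i, j), h⟩

/-- The index set of the coordinates of `ℝ^{3n(n-1)}`. -/
abbrev Index (n : ℕ) : Type := Pair n ⊕ Pair n ⊕ Pair n

/-- The concatenation `x ⊕ y ⊕ z`. -/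
def concat {n : ℕ} (x y z : Pair n → ℝ) : Index n → ℝ := Sum.elim x (Sum.elim y z)

/-- All entries are `0` or `1`. -/
def IsBinary {n : ℕ} (x : Pair n → ℝ) : Prop := ∀ p, x p = 0 ∨ x p = 1

/-- The symmetry and three-cycle constraints of the linear ordering problem. -/
structure OrderConstraints {n : ℕ} (x : Pair n → ℝ) : Prop where
  symm : ∀ (i j : Fin n) (h : i < j), x (pair i j h.ne) + x (pair j i h.ne') = 1
  trans : ∀ (i j k : Fin n) (hij : i < j) (hik : i < k) (hjk : j ≠ k),
    x (pair i j hij.ne) + x (pair j k hjk) + x (pair k i hik.ne') ≤ 2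

/-- The feasible points `x ⊕ y ⊕ z` of the diameter binary program of the linear ordering
problem on `n` elements. -/
def feasible (n : ℕ) : Set (Index n → ℝ) :=
  {v | ∃ x y z : Pair n → ℝ, v = concat x y z ∧
    IsBinary x ∧ IsBinary y ∧ IsBinary z ∧
    OrderConstraints x ∧ OrderConstraints y ∧
    ∀ p, x p + y p - z p ≤ 1}

/-- The diameter polytope of the linear ordering problem on `n` elements. -/
def polytope (n : ℕ) : Set (Index n → ℝ) := convexHull ℝ (feasible n)

/-- Zero-lifting of coefficients from `n` to `n + 1` elements: the coefficients of pairs of old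
elements are kept, those of pairs that involve the new element `Fin.last n` are zero. -/
def lift {n : ℕ} (a : Pair n → ℝ) : Pair (n + 1) → ℝ := fun p =>
  if h : p.1.1 ≠ Fin.last n ∧ p.1.2 ≠ Fin.last n then
    a (pair (p.1.1.castPred h.1) (p.1.2.castPred h.2)
      (fun e => p.2 (Fin.castPred_inj.mp e)))
  else 0

theorem lift_old {n : ℕ} (a : Pair n → ℝ) (i j : Fin n) (h : i ≠ j) :
    lift a (pair i.castSucc j.castSucc (fun e => h (Fin.castSucc_injective n e))) =
      a (pair i j h) := by
  simp [lift, Fin.castSucc_ne_last]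

theorem lift_to_last {n : ℕ} (a : Pair n → ℝ) (i : Fin n) :
    lift a (pair i.castSucc (Fin.last n) (Fin.castSucc_ne_last i)) = 0 := by
  simp [lift]

theorem lift_from_last {n : ℕ} (a : Pair n → ℝ) (i : Fin n) :
    lift a (pair (Fin.last n) i.castSucc (Fin.castSucc_ne_last i).symm) = 0 := by
  simp [lift]

end LOD

open Module

/-! Forgetting the new element is a linear map `restrict` that sends the polytope for `n + 1` onto
the one for `n`. The lifted functional is the old one composed with `restrict`, so the lifted face
F' is the part of the large polytope P' lying over the old face F, and it maps onto F. By
rank-nullity on direction spaces, F' and F have the same codimension in their polytopes as soon as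
the directions of F' and of P' meet `ker restrict` in the same subspace.

That equality needs only one fibre. Since `n ≥ 2` the face F is nonempty, so it contains a feasible
point `x ⊕ y ⊕ z`, and the whole fibre over this point lies in F'. The fibre already has all the
kernel directions (`mem_vectorSpan_of_restrict_eq_zero`): moving the new element past a single `i`
in one order changes only the two entries joining `i` to it, and each new entry of `z` can be
switched alone when the new element is first, or last, in both orders. By the symmetry equations
there are no further directions (`eq_concat_extendNew`). -/

theorem Submodule.finrank_map_add_finrank_inf_ker {K V W : Type*} [Field K] [AddCommGroup V]
    [Module K V] [AddCommGroup W] [Module K W] [FiniteDimensional K V] (f : V →ₗ[K] W)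
    (S : Submodule K V) :
    finrank K (S.map f) + finrank K (S ⊓ LinearMap.ker f : Submodule K V) = finrank K S := by
  rw [← LinearMap.finrank_range_add_finrank_ker (f.domRestrict S), LinearMap.range_domRestrict]
  congr 1
  have : (S ⊓ LinearMap.ker f : Submodule K V)
      = (LinearMap.ker (f.domRestrict S)).map S.subtype := by
    ext v
    simp [and_comm]
  rw [this]
  exact finrank_map_subtype_eq S _

theorem LinearMap.apply_mem_of_single_mem {R ι M : Type*} [Semiring R] [Fintype ι] [DecidableEq ι]
    [AddCommMonoid M] [Module R M] (f : (ι → R) →ₗ[R] M) {S : Submodule R M}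
    (h : ∀ i, f (Pi.single i 1) ∈ S) (u : ι → R) : f u ∈ S := by
  rw [pi_eq_sum_univ' u, map_sum]
  refine S.sum_mem fun i _ => ?_
  rw [map_smul]
  refine S.smul_mem _ ?_
  convert h i using 2

namespace LOD

theorem dim_of_nonempty {ι : Type} {S : Set (ι → ℝ)} (h : S.Nonempty) :
    dim S = finrank ℝ (vectorSpan ℝ S) := by
  rw [dim, if_neg h.ne_empty, direction_affineSpan]

/-! ### Coordinates on the old and the new pairs, and the restriction map. -/

section Pairs

variable {n : ℕ}

/-- A pair of old elements as a pair of elements of the enlarged ground set. -/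
def oldPair (p : Pair n) : Pair (n + 1) :=
  pair p.1.1.castSucc p.1.2.castSucc fun e => p.2 (Fin.castSucc_injective n e)

/-- The pair formed by an old element and the new one. -/
def toLast (i : Fin n) : Pair (n + 1) := pair i.castSucc (Fin.last n) (Fin.castSucc_ne_last i)

/-- The pair formed by the new element and an old one. -/
def fromLast (i : Fin n) : Pair (n + 1) :=
  pair (Fin.last n) i.castSucc (Fin.castSucc_ne_last i).symm

theorem pair_succ_cases {motive : Pair (n + 1) → Prop} (old : ∀ p, motive (oldPair p))
    (to_last : ∀ i, motive (toLast i)) (from_last : ∀ i, motive (fromLast i)) (p : Pair (n + 1)) :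
    motive p := by
  obtain ⟨⟨i, j⟩, h⟩ := p
  induction i using Fin.lastCases with
  | last =>
    induction j using Fin.lastCases with
    | last => exact absurd rfl h
    | cast j => exact from_last j
  | cast i =>
    induction j using Fin.lastCases with
    | last => exact to_last i
    | cast j => exact old (pair i j fun e => h (congrArg Fin.castSucc e))

theorem oldPair_injective : Function.Injective (oldPair (n := n)) := by
  rintro ⟨⟨i, j⟩, h⟩ ⟨⟨k, l⟩, h'⟩ e
  simpa [oldPair] using e

/-- The vector with old entries `x`, entries `s` at the pairs `(i, n + 1)` and entries `t` at the
pairs `(n + 1, i)`. -/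
def extend (x : Pair n → ℝ) (s t : Fin n → ℝ) : Pair (n + 1) → ℝ := fun p =>
  if h₂ : p.1.2 = Fin.last n then s (p.1.1.castPred fun e => p.2 (e.trans h₂.symm))
  else if h₁ : p.1.1 = Fin.last n then t (p.1.2.castPred h₂)
  else x (pair (p.1.1.castPred h₁) (p.1.2.castPred h₂) fun e => p.2 (Fin.castPred_inj.mp e))

@[simp]
theorem extend_oldPair (x : Pair n → ℝ) (s t : Fin n → ℝ) (p : Pair n) :
    extend x s t (oldPair p) = x p := by
  simp [extend, oldPair, Fin.castSucc_ne_last]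

@[simp]
theorem extend_toLast (x : Pair n → ℝ) (s t : Fin n → ℝ) (i : Fin n) :
    extend x s t (toLast i) = s i := by
  simp [extend, toLast]

@[simp]
theorem extend_fromLast (x : Pair n → ℝ) (s t : Fin n → ℝ) (i : Fin n) :
    extend x s t (fromLast i) = t i := by
  simp [extend, fromLast, Fin.castSucc_ne_last]

/-- Zero extension, as a linear function of the entries at the new pairs. -/
def extendNew : (Fin n → ℝ) × (Fin n → ℝ) →ₗ[ℝ] Pair (n + 1) → ℝ where
  toFun u := extend 0 u.1 u.2
  map_add' u v := by
    ext p
    induction p using pair_succ_cases <;> simp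
  map_smul' c u := by
    ext p
    induction p using pair_succ_cases <;> simp

theorem extend_sub_extend (x : Pair n → ℝ) (s t s' t' : Fin n → ℝ) :
    extend x s t - extend x s' t' = extendNew (s - s', t - t') := by
  ext p
  induction p using pair_succ_cases <;> simp [extendNew]

/-- Restriction of `x ⊕ y ⊕ z` to the pairs of old elements. -/
def restrict : (Index (n + 1) → ℝ) →ₗ[ℝ] Index n → ℝ :=
  LinearMap.funLeft ℝ ℝ (Sum.map oldPair (Sum.map oldPair oldPair))

theorem restrict_concat (x y z : Pair (n + 1) → ℝ) :
    restrict (concat x y z) = concat (x ∘ oldPair) (y ∘ oldPair) (z ∘ oldPair) := by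
  ext (p | p | p) <;> rfl

theorem lift_dotProduct (a : Pair n → ℝ) (x : Pair (n + 1) → ℝ) :
    lift a ⬝ᵥ x = a ⬝ᵥ (x ∘ oldPair) := by
  refine (Fintype.sum_of_injective oldPair oldPair_injective _ _ (fun p hp => ?_) fun p => ?_).symm
  · induction p using pair_succ_cases with
    | old p => exact absurd ⟨p, rfl⟩ hp
    | to_last i => rw [toLast, lift_to_last, zero_mul]
    | from_last i => rw [fromLast, lift_from_last, zero_mul]
  · rw [oldPair, lift_old, Function.comp_apply, oldPair]

theorem concat_eta (v : Index n → ℝ) :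
    concat (fun p => v (.inl p)) (fun p => v (.inr (.inl p))) (fun p => v (.inr (.inr p))) = v := by
  ext (p | p | p) <;> rfl

theorem concat_sub_concat (x y z x' y' z' : Pair n → ℝ) :
    concat x y z - concat x' y' z' = concat (x - x') (y - y') (z - z') := by
  ext (p | p | p) <;> rfl

theorem concat_dotProduct_concat (x y z x' y' z' : Pair n → ℝ) :
    concat x y z ⬝ᵥ concat x' y' z' = x ⬝ᵥ x' + (y ⬝ᵥ y' + z ⬝ᵥ z') := by
  simp [concat, dotProduct, Fintype.sum_sum_type]

theorem concat_lift_dotProduct (ax ay az : Pair n → ℝ) (v : Index (n + 1) → ℝ) :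
    concat (lift ax) (lift ay) (lift az) ⬝ᵥ v = concat ax ay az ⬝ᵥ restrict v := by
  rw [← concat_eta v, restrict_concat]
  simp only [concat_dotProduct_concat, lift_dotProduct]

end Pairs

/-! ### Inserting a new element into a linear order. -/

section Orders

variable {n : ℕ} {x y z : Pair n → ℝ}

/-- The elements `i` with `s i = 1` form an initial segment of the linear order `x`. -/
structure IsInitial (x : Pair n → ℝ) (s : Fin n → ℝ) : Prop where
  binary : ∀ i, s i = 0 ∨ s i = 1
  down : ∀ i j (h : i ≠ j), x (pair i j h) = 1 → s j = 1 → s i = 1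

theorem isInitial_zero (x : Pair n → ℝ) : IsInitial x 0 := ⟨by simp, by simp⟩

theorem isInitial_one (x : Pair n → ℝ) : IsInitial x 1 := ⟨by simp, by simp⟩

theorem OrderConstraints.symm_of_ne (hx : OrderConstraints x) {i j : Fin n} (h : i ≠ j) :
    x (pair i j h) + x (pair j i h.symm) = 1 := by
  rcases h.lt_or_gt with h' | h'
  · exact hx.symm i j h'
  · rw [add_comm]
    exact hx.symm j i h'

/-- The defining constraints list each directed three-cycle once, starting at its least element; any
other starting point is a rotation. -/
theorem OrderConstraints.trans_of_ne (hx : OrderConstraints x) {i j k : Fin n} (hij : i ≠ j)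
    (hjk : j ≠ k) (hki : k ≠ i) :
    x (pair i j hij) + x (pair j k hjk) + x (pair k i hki) ≤ 2 := by
  rcases hij.lt_or_gt with h₁ | h₁
  · rcases hki.lt_or_gt with h₂ | h₂
    · linarith [hx.trans k i j h₂ (h₂.trans h₁) hij]
    · exact hx.trans i j k h₁ h₂ hjk
  · rcases hjk.lt_or_gt with h₂ | h₂
    · linarith [hx.trans j k i h₂ h₁ hki]
    · linarith [hx.trans k i j (h₂.trans h₁) h₂ hij]

/-- The strict predecessors of `i` in `x`. -/
def before (x : Pair n → ℝ) (i : Fin n) : Fin n → ℝ := fun j =>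
  if h : j ≠ i then x (pair j i h) else 0

theorem isInitial_before (hb : IsBinary x) (hx : OrderConstraints x) (i : Fin n) :
    IsInitial x (before x i) where
  binary j := by
    by_cases h : j = i
    · simp [before, h]
    · simpa [before, h] using hb _
  down j k h hjk hk := by
    by_cases hki : k = i
    · simp [before, hki] at hk
    simp only [before, ne_eq, hki, not_false_eq_true, dite_true] at hk
    -- `j = i` would put `i` and `k` each before the other; otherwise the three-cycle constraint
    -- forces `j` before `i`.
    by_cases hji : j = i
    · subst hji
      linarith [hx.symm_of_ne h]
    have h₁ := hx.trans_of_ne h hki (Ne.symm hji)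
    have h₂ := hx.symm_of_ne hji
    simp only [before, ne_eq, hji, not_false_eq_true, dite_true]
    rcases hb (pair j i hji) with h₃ | h₃ <;> linarith

theorem isInitial_before_add_single (hb : IsBinary x) (hx : OrderConstraints x) (i : Fin n) :
    IsInitial x (before x i + Pi.single i 1) where
  binary j := by
    by_cases h : j = i
    · subst h
      simp [before]
    · simpa [h] using (isInitial_before hb hx i).binary j
  down j k h hjk hk := by
    by_cases hji : j = i
    · subst hji
      simp [before]
    by_cases hki : k = i
    · subst hki
      simp [before, hji, hjk]
    simpa [hji] using (isInitial_before hb hx i).down j k h hjk (by simpa [hki] using hk)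

theorem IsBinary.extend (hx : IsBinary x) {s t : Fin n → ℝ} (hs : ∀ i, s i = 0 ∨ s i = 1)
    (ht : ∀ i, t i = 0 ∨ t i = 1) : IsBinary (extend x s t) := by
  intro p
  induction p using pair_succ_cases with
  | old p => simpa using hx p
  | to_last i => simpa using hs i
  | from_last i => simpa using ht i

/-- A violated three-cycle through the new element would consist of an old `a` before an old `b`
with `s b = 1` and `s a = 0`, which an initial segment excludes. The new element has the largest
index, so it never plays the role of the least element `i`. -/
theorem OrderConstraints.extend (hb : IsBinary x) (hx : OrderConstraints x) {s : Fin n → ℝ}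
    (hs : IsInitial x s) : OrderConstraints (extend x s (1 - s)) where
  symm i j h := by
    induction i using Fin.lastCases with
    | last => exact absurd h (Fin.le_last j).not_gt
    | cast i =>
      induction j using Fin.lastCases with
      | last =>
        have h₁ := extend_toLast x s (1 - s) i
        have h₂ := extend_fromLast x s (1 - s) i
        simp only [toLast, fromLast, Pi.sub_apply, Pi.one_apply] at h₁ h₂
        rw [h₁, h₂]
        ring
      | cast j =>
        have h' : i < j := h
        have h₁ := extend_oldPair x s (1 - s) (pair i j h'.ne)
        have h₂ := extend_oldPair x s (1 - s) (pair j i h'.ne')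
        simp only [oldPair] at h₁ h₂
        rw [h₁, h₂]
        exact hx.symm i j h'
  trans i j k hij hik hjk := by
    induction i using Fin.lastCases with
    | last => exact absurd hij (Fin.le_last j).not_gt
    | cast i =>
      induction j using Fin.lastCases with
      | last =>
        induction k using Fin.lastCases with
        | last => exact absurd rfl hjk
        | cast k =>
          have h' : i < k := hik
          have h₁ := extend_toLast x s (1 - s) i
          have h₂ := extend_fromLast x s (1 - s) k
          have h₃ := extend_oldPair x s (1 - s) (pair k i h'.ne')
          simp only [toLast, fromLast, oldPair, Pi.sub_apply, Pi.one_apply] at h₁ h₂ h₃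
          rw [h₁, h₂, h₃]
          have h₄ := hs.down k i h'.ne'
          rcases hs.binary i with h₅ | h₅ <;> rcases hs.binary k with h₆ | h₆ <;>
            rcases hb (pair k i h'.ne') with h₇ | h₇ <;> simp_all <;> norm_num
      | cast j =>
        have h' : i < j := hij
        induction k using Fin.lastCases with
        | last =>
          have h₁ := extend_toLast x s (1 - s) j
          have h₂ := extend_fromLast x s (1 - s) i
          have h₃ := extend_oldPair x s (1 - s) (pair i j h'.ne)
          simp only [toLast, fromLast, oldPair, Pi.sub_apply, Pi.one_apply] at h₁ h₂ h₃
          rw [h₁, h₂, h₃]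
          have h₄ := hs.down i j h'.ne
          rcases hs.binary i with h₅ | h₅ <;> rcases hs.binary j with h₆ | h₆ <;>
            rcases hb (pair i j h'.ne) with h₇ | h₇ <;> simp_all <;> norm_num
        | cast k =>
          have h'' : i < k := hik
          have hjk' : j ≠ k := fun e => hjk (congrArg Fin.castSucc e)
          have h₁ := extend_oldPair x s (1 - s) (pair i j h'.ne)
          have h₂ := extend_oldPair x s (1 - s) (pair j k hjk')
          have h₃ := extend_oldPair x s (1 - s) (pair k i h''.ne')
          simp only [oldPair] at h₁ h₂ h₃
          rw [h₁, h₂, h₃]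
          exact hx.trans i j k h' h'' hjk'

theorem OrderConstraints.comp_oldPair {x : Pair (n + 1) → ℝ} (hx : OrderConstraints x) :
    OrderConstraints (x ∘ oldPair) where
  symm i j h := hx.symm i.castSucc j.castSucc h
  trans i j k hij hik hjk := hx.trans i.castSucc j.castSucc k.castSucc hij hik
    fun e => hjk (Fin.castSucc_injective n e)

/-- The conditions on the parts of a feasible point `x ⊕ y ⊕ z`. -/
structure IsFeasible (x y z : Pair n → ℝ) : Prop where
  binary_x : IsBinary x
  binary_y : IsBinary y
  binary_z : IsBinary z
  order_x : OrderConstraints x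
  order_y : OrderConstraints y
  link : ∀ p, x p + y p - z p ≤ 1

theorem IsFeasible.concat_mem (h : IsFeasible x y z) : concat x y z ∈ feasible n :=
  ⟨x, y, z, rfl, h.1, h.2, h.3, h.4, h.5, h.6⟩

theorem exists_isFeasible_of_mem {v : Index n → ℝ} (h : v ∈ feasible n) :
    ∃ x y z, IsFeasible x y z ∧ v = concat x y z := by
  obtain ⟨x, y, z, rfl, h₁, h₂, h₃, h₄, h₅, h₆⟩ := h
  exact ⟨x, y, z, ⟨h₁, h₂, h₃, h₄, h₅, h₆⟩, rfl⟩

theorem IsFeasible.extend (h : IsFeasible x y z) {s s' σ τ : Fin n → ℝ} (hs : IsInitial x s)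
    (hs' : IsInitial y s') (hσ : ∀ i, σ i = 0 ∨ σ i = 1) (hτ : ∀ i, τ i = 0 ∨ τ i = 1)
    (hto : ∀ i, s i + s' i - σ i ≤ 1) (hfrom : ∀ i, 1 - s i + (1 - s' i) - τ i ≤ 1) :
    IsFeasible (extend x s (1 - s)) (extend y s' (1 - s')) (extend z σ τ) where
  binary_x := h.binary_x.extend hs.binary fun i => by
    rcases hs.binary i with h | h <;> simp [h]
  binary_y := h.binary_y.extend hs'.binary fun i => by
    rcases hs'.binary i with h | h <;> simp [h]
  binary_z := h.binary_z.extend hσ hτ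
  order_x := h.order_x.extend h.binary_x hs
  order_y := h.order_y.extend h.binary_y hs'
  link p := by
    induction p using pair_succ_cases with
    | old p => simpa using h.link p
    | to_last i => simpa using hto i
    | from_last i => simpa using hfrom i

theorem IsInitial.le_one {s : Fin n → ℝ} (hs : IsInitial x s) (i : Fin n) : s i ≤ 1 := by
  rcases hs.binary i with h | h <;> norm_num [h]

theorem IsInitial.nonneg {s : Fin n → ℝ} (hs : IsInitial x s) (i : Fin n) : 0 ≤ s i := by
  rcases hs.binary i with h | h <;> norm_num [h]

/-- With all new entries of `z` equal to 1 the linking constraints on new pairs hold automatically,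
so the new element can be placed in the two orders independently. -/
theorem IsFeasible.extend_one (h : IsFeasible x y z) {s s' : Fin n → ℝ} (hs : IsInitial x s)
    (hs' : IsInitial y s') :
    IsFeasible (LOD.extend x s (1 - s)) (LOD.extend y s' (1 - s')) (LOD.extend z 1 1) :=
  h.extend hs hs' (by simp) (by simp)
    (fun i => by simpa using by linarith [hs.le_one i, hs'.le_one i])
    (fun i => by simpa using by linarith [hs.nonneg i, hs'.nonneg i])

theorem restrict_concat_extend (s t s' t' σ τ : Fin n → ℝ) :
    restrict (concat (extend x s t) (extend y s' t') (extend z σ τ)) = concat x y z := by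
  rw [restrict_concat]
  congr 1 <;> ext p <;> simp

end Orders

/-! ### The projection of polytopes and faces, and the directions of its fibres. -/

section Polytope

variable {n : ℕ}

theorem restrict_image_feasible : restrict '' feasible (n + 1) = feasible n := by
  ext v
  constructor
  · rintro ⟨w, hw, rfl⟩
    obtain ⟨x, y, z, h, rfl⟩ := exists_isFeasible_of_mem hw
    rw [restrict_concat]
    exact IsFeasible.concat_mem ⟨fun p => h.1 _, fun p => h.2 _, fun p => h.3 _,
      h.4.comp_oldPair, h.5.comp_oldPair, fun p => h.6 _⟩
  · intro hv
    obtain ⟨x, y, z, h, rfl⟩ := exists_isFeasible_of_mem hv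
    -- A preimage: the new element goes first in both orders.
    exact ⟨_, (h.extend_one (isInitial_zero x) (isInitial_zero y)).concat_mem,
      restrict_concat_extend ..⟩

theorem restrict_image_polytope : restrict '' polytope (n + 1) = polytope n := by
  rw [polytope, LinearMap.image_convexHull, restrict_image_feasible, polytope]

theorem restrict_mem_polytope {v : Index (n + 1) → ℝ} (hv : v ∈ polytope (n + 1)) :
    restrict v ∈ polytope n :=
  restrict_image_polytope ▸ Set.mem_image_of_mem restrict hv

theorem feasible_subset_polytope : feasible n ⊆ polytope n := subset_convexHull ℝ _

theorem face_lift (ax ay az : Pair n → ℝ) (a₀ : ℝ) :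
    face (polytope (n + 1)) (concat (lift ax) (lift ay) (lift az)) a₀ =
      polytope (n + 1) ∩ restrict ⁻¹' face (polytope n) (concat ax ay az) a₀ := by
  ext v
  simp only [face, Set.mem_ofPred_eq, Set.mem_inter_iff, Set.mem_preimage, concat_lift_dotProduct]
  exact ⟨fun h => ⟨h.1, restrict_mem_polytope h.1, h.2⟩, fun h => ⟨h.1, h.2.2⟩⟩

theorem restrict_image_face_lift (ax ay az : Pair n → ℝ) (a₀ : ℝ) :
    restrict '' face (polytope (n + 1)) (concat (lift ax) (lift ay) (lift az)) a₀ =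
      face (polytope n) (concat ax ay az) a₀ := by
  rw [face_lift, Set.image_inter_preimage, restrict_image_polytope]
  exact Set.inter_eq_right.mpr fun v hv => hv.1

/-- A nonempty face contains a feasible point. -/
theorem exists_feasible_mem_face {a : Index n → ℝ} {a₀ : ℝ} (hv : ∀ v ∈ polytope n, a ⬝ᵥ v ≤ a₀)
    (hne : (face (polytope n) a a₀).Nonempty) : ∃ v ∈ feasible n, a ⬝ᵥ v = a₀ := by
  by_contra! hlt
  obtain ⟨w, hw, hw₀⟩ := hne
  -- If every feasible point were strict, this open half-space would contain their convex hull,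
  -- hence the face.
  have hconv : Convex ℝ {v | dotProductBilin ℝ ℝ a v < a₀} :=
    convex_halfSpace_lt (dotProductBilin ℝ ℝ a).isLinear a₀
  have hsub : polytope n ⊆ {v | dotProductBilin ℝ ℝ a v < a₀} :=
    convexHull_min (fun v h => (hv v (feasible_subset_polytope h)).lt_of_ne (hlt v h)) hconv
  exact (hsub hw).ne hw₀

theorem vectorSpan_le_ker {E : Type*} [AddCommGroup E] [Module ℝ E] {f : E →ₗ[ℝ] ℝ} {c : ℝ}
    {S : Set E} (h : ∀ v ∈ S, f v = c) :
    vectorSpan ℝ (convexHull ℝ S) ≤ LinearMap.ker f := by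
  rw [← direction_affineSpan, affineSpan_convexHull, direction_affineSpan, vectorSpan,
    Submodule.span_le]
  rintro _ ⟨v, hv, w, hw, rfl⟩
  simp [h v hv, h w hw]

/-- The symmetry equations have constant right-hand side on feasible points, so differences satisfy
the homogeneous versions. The `z` part carries no such equation. -/
theorem symm_of_mem_vectorSpan {w : Index n → ℝ} (hw : w ∈ vectorSpan ℝ (polytope n))
    {i j : Fin n} (h : i ≠ j) :
    w (.inl (pair i j h)) + w (.inl (pair j i h.symm)) = 0 ∧
      w (.inr (.inl (pair i j h))) + w (.inr (.inl (pair j i h.symm))) = 0 := by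
  have key : ∀ k l : Index n, (∀ v ∈ feasible n, v k + v l = 1) → w k + w l = 0 := by
    intro k l hkl
    have := vectorSpan_le_ker
      (f := LinearMap.proj (R := ℝ) (φ := fun _ => ℝ) k + LinearMap.proj l) hkl hw
    simpa using this
  refine ⟨key _ _ fun v hv => ?_, key _ _ fun v hv => ?_⟩ <;>
    obtain ⟨x, y, z, hf, rfl⟩ := exists_isFeasible_of_mem hv
  · exact hf.order_x.symm_of_ne h
  · exact hf.order_y.symm_of_ne h

/-- Vectors supported on the new pairs and antisymmetric there in their first two parts are spanned
by the obvious ones. -/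
theorem concat_extendNew_mem {S : Submodule ℝ (Index (n + 1) → ℝ)}
    (hx : ∀ i, concat (extendNew (Pi.single i 1, -Pi.single i 1)) 0 0 ∈ S)
    (hy : ∀ i, concat 0 (extendNew (Pi.single i 1, -Pi.single i 1)) 0 ∈ S)
    (hto : ∀ i, concat 0 0 (extendNew (Pi.single i 1, 0)) ∈ S)
    (hfrom : ∀ i, concat 0 0 (extendNew (0, Pi.single i 1)) ∈ S) (u u' σ τ : Fin n → ℝ) :
    concat (extendNew (u, -u)) (extendNew (u', -u')) (extendNew (σ, τ)) ∈ S := by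
  let cx : (Pair (n + 1) → ℝ) →ₗ[ℝ] Index (n + 1) → ℝ :=
    { toFun x := concat x 0 0
      map_add' x y := by ext (p | p | p) <;> simp [concat]
      map_smul' c x := by ext (p | p | p) <;> simp [concat] }
  let cy : (Pair (n + 1) → ℝ) →ₗ[ℝ] Index (n + 1) → ℝ :=
    { toFun x := concat 0 x 0
      map_add' x y := by ext (p | p | p) <;> simp [concat]
      map_smul' c x := by ext (p | p | p) <;> simp [concat] }
  let cz : (Pair (n + 1) → ℝ) →ₗ[ℝ] Index (n + 1) → ℝ :=
    { toFun x := concat 0 0 x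
      map_add' x y := by ext (p | p | p) <;> simp [concat]
      map_smul' c x := by ext (p | p | p) <;> simp [concat] }
  let d : (Fin n → ℝ) →ₗ[ℝ] (Fin n → ℝ) × (Fin n → ℝ) := LinearMap.id.prod (-LinearMap.id)
  have h₁ := (cx ∘ₗ extendNew ∘ₗ d).apply_mem_of_single_mem hx u
  have h₂ := (cy ∘ₗ extendNew ∘ₗ d).apply_mem_of_single_mem hy u'
  have h₃ := (cz ∘ₗ extendNew ∘ₗ LinearMap.inl ℝ _ _).apply_mem_of_single_mem hto σ
  have h₄ := (cz ∘ₗ extendNew ∘ₗ LinearMap.inr ℝ _ _).apply_mem_of_single_mem hfrom τ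
  convert S.add_mem (S.add_mem h₁ h₂) (S.add_mem h₃ h₄) using 1
  ext (p | p | p) <;> induction p using pair_succ_cases <;>
    simp [cx, cy, cz, d, concat, extendNew]

/-- Vectors of the kernel of the restriction that satisfy the homogeneous symmetry equations. -/
theorem eq_concat_extendNew {w : Index (n + 1) → ℝ} (hw : w ∈ vectorSpan ℝ (polytope (n + 1)))
    (hker : restrict w = 0) :
    w = concat
      (extendNew (fun i => w (.inl (toLast i)), -fun i => w (.inl (toLast i))))
      (extendNew (fun i => w (.inr (.inl (toLast i))), -fun i => w (.inr (.inl (toLast i)))))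
      (extendNew (fun i => w (.inr (.inr (toLast i))), fun i => w (.inr (.inr (fromLast i))))) := by
  have hs := fun i : Fin n => symm_of_mem_vectorSpan hw (Fin.castSucc_ne_last i)
  ext (p | p | p) <;> induction p using pair_succ_cases with
  | old p =>
    simp only [concat, extendNew, LinearMap.coe_mk, AddHom.coe_mk, Sum.elim_inl, Sum.elim_inr,
      extend_oldPair, Pi.zero_apply]
    first
      | exact congrFun hker (.inl p)
      | exact congrFun hker (.inr (.inl p))
      | exact congrFun hker (.inr (.inr p))
  | to_last i => simp [concat, extendNew]
  | from_last i =>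
    simp only [concat, extendNew, LinearMap.coe_mk, AddHom.coe_mk, Sum.elim_inl, Sum.elim_inr,
      extend_fromLast, Pi.neg_apply]
    try first
      | exact eq_neg_of_add_eq_zero_right (hs i).1
      | exact eq_neg_of_add_eq_zero_right (hs i).2

/-- The extensions of a feasible point span all directions of the enlarged polytope that vanish on
the old pairs. -/
theorem mem_vectorSpan_of_restrict_eq_zero {x y z : Pair n → ℝ} (h : IsFeasible x y z)
    {w : Index (n + 1) → ℝ} (hw : w ∈ vectorSpan ℝ (polytope (n + 1))) (hker : restrict w = 0) :
    w ∈ vectorSpan ℝ (polytope (n + 1) ∩ restrict ⁻¹' {concat x y z}) := by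
  -- The difference of two feasible points in the fibre; the complementary entries give `(1 - s) -
  -- (1 - t) = t - s`.
  have key {s s' σ τ t t' σ' τ' : Fin n → ℝ}
      (h₁ : IsFeasible (extend x s (1 - s)) (extend y s' (1 - s')) (extend z σ τ))
      (h₂ : IsFeasible (extend x t (1 - t)) (extend y t' (1 - t')) (extend z σ' τ')) :
      concat (extendNew (s - t, t - s)) (extendNew (s' - t', t' - s'))
        (extendNew (σ - σ', τ - τ')) ∈
        vectorSpan ℝ (polytope (n + 1) ∩ restrict ⁻¹' {concat x y z}) := by
    have := vsub_mem_vectorSpan ℝ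
      (s := polytope (n + 1) ∩ restrict ⁻¹' {concat x y z})
      ⟨feasible_subset_polytope h₁.concat_mem, restrict_concat_extend ..⟩
      ⟨feasible_subset_polytope h₂.concat_mem, restrict_concat_extend ..⟩
    rw [vsub_eq_sub, concat_sub_concat, extend_sub_extend, extend_sub_extend,
      extend_sub_extend, sub_sub_sub_cancel_left, sub_sub_sub_cancel_left] at this
    exact this
  have hzero : extendNew ((0 : Fin n → ℝ), (0 : Fin n → ℝ)) = 0 := map_zero extendNew
  have hx0 := isInitial_zero x
  have hy0 := isInitial_zero y
  have hx1 := isInitial_one x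
  have hy1 := isInitial_one y
  have hsingle (i : Fin n) : ∀ j, (Pi.single i 1 : Fin n → ℝ) j = 0 ∨
      (Pi.single i 1 : Fin n → ℝ) j = 1 := by
    intro j
    by_cases e : j = i
    · subst e
      simp
    · simp [e]
  have hnonneg (i j : Fin n) : 0 ≤ (Pi.single i 1 : Fin n → ℝ) j := by
    rcases hsingle i j with e | e <;> norm_num [e]
  rw [eq_concat_extendNew hw hker]
  refine concat_extendNew_mem (fun i => ?_) (fun i => ?_) (fun i => ?_) (fun i => ?_) _ _ _ _
  -- Placing the new element just after and just before `i` in `x`, all else fixed, isolates the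
  -- direction of `i`.
  · have hb := isInitial_before h.binary_x h.order_x i
    have ha := isInitial_before_add_single h.binary_x h.order_x i
    simpa [hzero] using key (h.extend_one ha hy0) (h.extend_one hb hy0)
  · have hb := isInitial_before h.binary_y h.order_y i
    have ha := isInitial_before_add_single h.binary_y h.order_y i
    simpa [hzero] using key (h.extend_one hx0 ha) (h.extend_one hx0 hb)
  -- With the new element first in both orders, `z` is forced to 1 on the pairs from it and is free
  -- on the pairs to it.
  · simpa [hzero] using key
      (h.extend hx0 hy0 (hsingle i) (τ := 1) (by simp)
        (fun j => by simpa using by linarith [hnonneg i j]) (by simp))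
      (h.extend hx0 hy0 (σ := 0) (τ := 1) (by simp) (by simp) (by simp) (by simp))
  -- The mirror case: with the new element last in both orders, `z` is free on the pairs from it.
  · simpa [hzero] using key
      (h.extend hx1 hy1 (σ := 1) (by simp) (hsingle i) (by simp)
        (fun j => by simpa using by linarith [hnonneg i j]))
      (h.extend hx1 hy1 (σ := 1) (τ := 0) (by simp) (by simp) (by simp) (by simp))

/-- The natural order. -/
def ascending (n : ℕ) : Pair n → ℝ := fun p => if p.1.1 < p.1.2 then 1 else 0

/-- The reverse of the natural order. -/
def descending (n : ℕ) : Pair n → ℝ := fun p => if p.1.2 < p.1.1 then 1 else 0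

/-- Opposite orders satisfy `x + y = 1` at every pair, so the linking constraints leave `z`
arbitrary. -/
theorem isFeasible_ascending_descending {z : Pair n → ℝ} (hz : IsBinary z) :
    IsFeasible (ascending n) (descending n) z where
  binary_x p := by
    simp only [ascending]
    split_ifs <;> simp
  binary_y p := by
    simp only [descending]
    split_ifs <;> simp
  binary_z := hz
  order_x := ⟨fun i j h => by simp [ascending, h, h.not_gt],
    fun i j k hij hik hjk => by
      simp only [ascending, hij, hik.not_gt, if_true, if_false]
      split_ifs <;> norm_num⟩
  order_y := ⟨fun i j h => by simp [descending, h, h.not_gt],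
    fun i j k hij hik hjk => by
      simp only [descending, hij.not_gt, hik, if_true, if_false]
      split_ifs <;> norm_num⟩
  link p := by
    have h₁ : 0 ≤ z p := by rcases hz p with h | h <;> norm_num [h]
    simp only [ascending, descending]
    rcases p.2.lt_or_gt with h | h <;> simpa [h, h.not_gt] using h₁

theorem polytope_nonempty (n : ℕ) : (polytope n).Nonempty :=
  ⟨_, feasible_subset_polytope
    (isFeasible_ascending_descending (z := 0) fun _ => .inl rfl).concat_mem⟩

/-- Over two opposite orders, `z = 0` and `z = 1` give distinct points once some pair exists, which
is where `2 ≤ n` enters. -/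
theorem dim_polytope_pos (hn : 2 ≤ n) : 0 < dim (polytope n) := by
  rw [dim_of_nonempty (polytope_nonempty n), Nat.cast_pos, Module.finrank_pos_iff_exists_ne_zero]
  have h₀ := isFeasible_ascending_descending (n := n) (z := 0) fun _ => .inl rfl
  have h₁ := isFeasible_ascending_descending (n := n) (z := 1) fun _ => .inr rfl
  refine ⟨⟨_, vsub_mem_vectorSpan ℝ (feasible_subset_polytope h₁.concat_mem)
    (feasible_subset_polytope h₀.concat_mem)⟩, fun e => ?_⟩
  have := congrFun (congrArg Subtype.val e)
    (.inr (.inr (pair ⟨0, by omega⟩ ⟨1, by omega⟩ (by simp))))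
  simp [concat] at this

end Polytope

end LOD

theorem mainTheorem9 (n : ℕ) (hn : 2 ≤ n) (ax ay az : LOD.Pair n → ℝ) (a₀ : ℝ)
    (h : LOD.DefinesFacet (LOD.polytope n) (LOD.concat ax ay az) a₀) :
    LOD.DefinesFacet (LOD.polytope (n + 1))
      (LOD.concat (LOD.lift ax) (LOD.lift ay) (LOD.lift az)) a₀ := by
  open LOD in
  obtain ⟨hvalid, hdim⟩ := h
  refine ⟨fun v hv => ?_, ?_⟩
  · rw [concat_lift_dotProduct]
    exact hvalid _ (restrict_mem_polytope hv)
  -- An empty face has dimension -1, so it could be a facet only of a polytope of dimension 0.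
  have hF : (face (polytope n) (concat ax ay az) a₀).Nonempty := by
    by_contra hempty
    rw [Set.not_nonempty_iff_eq_empty] at hempty
    have := dim_polytope_pos hn
    simp only [hempty, dim, if_true] at hdim this
    omega
  have himage := restrict_image_face_lift ax ay az a₀
  have hF' : (face (polytope (n + 1)) (concat (lift ax) (lift ay) (lift az)) a₀).Nonempty := by
    rw [← Set.image_nonempty (f := restrict), himage]
    exact hF
  obtain ⟨v, hv, hva⟩ := exists_feasible_mem_face hvalid hF
  obtain ⟨x, y, z, hf, rfl⟩ := exists_isFeasible_of_mem hv
  set F' := face (polytope (n + 1)) (concat (lift ax) (lift ay) (lift az)) a₀ with hF'_def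
  -- The fibre over the feasible point of the old face lies inside `F'` and already spans every
  -- kernel direction of the large polytope.
  have hker : vectorSpan ℝ (polytope (n + 1)) ⊓ LinearMap.ker restrict =
      vectorSpan ℝ F' ⊓ LinearMap.ker restrict := by
    refine le_antisymm (fun w hw => ⟨?_, hw.2⟩)
      (inf_le_inf_right _ (vectorSpan_mono ℝ fun _ hw => hw.1))
    refine vectorSpan_mono ℝ ?_ (mem_vectorSpan_of_restrict_eq_zero hf hw.1 hw.2)
    rw [hF'_def, face_lift]
    rintro u ⟨hu, hu'⟩
    refine ⟨hu, ?_⟩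
    rw [Set.mem_preimage, show restrict u = _ from hu']
    exact ⟨feasible_subset_polytope hv, hva⟩
  have hP_map : (vectorSpan ℝ (polytope (n + 1))).map restrict = vectorSpan ℝ (polytope n) :=
    (AffineMap.map_vectorSpan restrict.toAffineMap).trans
      (congrArg (vectorSpan ℝ) restrict_image_polytope)
  have hF_map : (vectorSpan ℝ F').map restrict =
      vectorSpan ℝ (face (polytope n) (concat ax ay az) a₀) :=
    (AffineMap.map_vectorSpan restrict.toAffineMap).trans (congrArg (vectorSpan ℝ) himage)
  -- Both dimensions exceed those of their images by the same kernel term, so the codimension 1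
  -- carries over.
  have h₁ := Submodule.finrank_map_add_finrank_inf_ker restrict (vectorSpan ℝ (polytope (n + 1)))
  have h₂ := Submodule.finrank_map_add_finrank_inf_ker restrict (vectorSpan ℝ F')
  rw [hP_map, hker] at h₁
  rw [hF_map] at h₂
  rw [dim_of_nonempty hF, dim_of_nonempty (polytope_nonempty n)] at hdim
  rw [dim_of_nonempty hF', dim_of_nonempty (polytope_nonempty (n + 1))]
  omega
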